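/- Let $n\ge 2$ and let $\Omega\subset\mathbb R^n$ be a domain (a connected non-empty open set). Let $A=(a_{ij}):\Omega\to\mathbb R^{n\times n}$ be measurable, write $H(x,\xi)=\langle A(x)\xi,\xi\rangle=\sum_{i,j}\xi_i a_{ij}(x)\xi_j$, and assume that $A$ is elliptic: there is a continuous function $\lambda:\Omega\to[1,\infty)$ such that, for almost every $x\in\Omega$ and all $\xi\in\mathbb R^n$, $$\frac1{\lambda(x)}|\xi|^2\le H(x,\xi)\le\lambda(x)|\xi|^2 .$$ Assume that $A$ is weak upper semicontinuous on $\Omega$, that is, for every $\xi\in S^{n-1}$ and for almost every $x\in\Omega$ there is a set $E$ of Lebesgue measure zero with $$\limsup_{\Omega\setminus E\,\ni\, y\to x}H(y,\xi)\le H(x,\xi).$$ For $x,y\in\Omega$ let $$d_A(x,y)=\sup\bigl\{v(x)-v(y)\;:\;v\in C(\Omega)\cap W^{1,2}_{\mathrm{loc}}(\Omega),\ H(z,\nabla v(z))\le1\text{ for a.e. }z\in\Omega\bigr\}$$ be the intrinsic distance of $A$, where $\nabla v$ is the weak gradient, and for $u:\Omega\to\mathbb R$ let $$\operatorname{Lip}_{d_A}u(x)=\limsup_{y\to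 x,\ y\ne x}\frac{|u(y)-u(x)|}{d_A(x,y)} .$$ Then every function $u:\Omega\to\mathbb R$ that is Lipschitz with respect to the Euclidean metric satisfies, for almost every $x\in\Omega$, that $u$ is differentiable at $x$ and $$\bigl(\operatorname{Lip}_{d_A}u(x)\bigr)^2=\langle A(x)\nabla u(x),\nabla u(x)\rangle .$$ -/

import Mathlib

open Filter Topology MeasureTheory Set
open scoped ENNReal ContDiff

noncomputable section

namespace IntrinsicDistance

/-- `n`-dimensional Euclidean space. -/
abbrev Eucl (n : ℕ) : Type := EuclideanSpace ℝ (Fin n)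

/-- The Hamiltonian `H(x, ξ) = ⟨A(x) ξ, ξ⟩ = ∑ᵢⱼ ξᵢ aᵢⱼ(x) ξⱼ`. -/
def hamiltonian {n : ℕ} (A : Eucl n → Matrix (Fin n) (Fin n) ℝ) (x ξ : Eucl n) : ℝ :=
  ∑ i, ∑ j, ξ i * A x i j * ξ j

/-- The class of diffusion matrices on `Ω`: (Lebesgue) measurable matrix-valued maps on `Ω` that
are elliptic with a continuous ellipticity function `lam : Ω → [1, ∞)`.  Only the values of `A`
on `Ω` matter. -/
structure IsDiffusionMatrix {n : ℕ} (Ω : Set (Eucl n))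
    (A : Eucl n → Matrix (Fin n) (Fin n) ℝ) : Prop where
  measurable : ∀ i j, AEMeasurable (fun x => A x i j) (volume.restrict Ω)
  elliptic : ∃ lam : Eucl n → ℝ, ContinuousOn lam Ω ∧ (∀ x ∈ Ω, 1 ≤ lam x) ∧
    ∀ᵐ x ∂(volume.restrict Ω), ∀ ξ : Eucl n,
      (lam x)⁻¹ * ‖ξ‖ ^ 2 ≤ hamiltonian A x ξ ∧ hamiltonian A x ξ ≤ lam x * ‖ξ‖ ^ 2

/-- `f` is weak upper semicontinuous at `x`: for some null set `E`, the upper limit of `f(y)` as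
`y → x` within `Ω \ E` is at most `f(x)`.  The upper limit is taken in `[-∞, ∞]`. -/
def WeakUSCAt {n : ℕ} (Ω : Set (Eucl n)) (f : Eucl n → ℝ) (x : Eucl n) : Prop :=
  ∃ E : Set (Eucl n), volume E = 0 ∧
    limsup (fun y => (f y : EReal)) (𝓝[Ω \ E] x) ≤ (f x : EReal)

/-- The matrix-valued map `A` is weak upper semicontinuous on `Ω`: for every unit vector `ξ`,
`⟨A(·) ξ, ξ⟩` is weak upper semicontinuous at almost every point of `Ω`. -/
def WeakUSCOn {n : ℕ} (Ω : Set (Eucl n)) (A : Eucl n → Matrix (Fin n) (Fin n) ℝ) : Prop :=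
  ∀ ξ : Eucl n, ‖ξ‖ = 1 →
    ∀ᵐ x ∂(volume.restrict Ω), WeakUSCAt Ω (fun y => hamiltonian A y ξ) x

/-- `u` belongs to `W^{1,2}_loc(Ω)` and `g` is (a representative of) its weak gradient. -/
structure HasSobolevGradient {n : ℕ} (Ω : Set (Eucl n)) (u : Eucl n → ℝ)
    (g : Eucl n → Eucl n) : Prop where
  memLp_fun : ∀ K : Set (Eucl n), IsCompact K → K ⊆ Ω → MemLp u 2 (volume.restrict K)
  memLp_grad : ∀ K : Set (Eucl n), IsCompact K → K ⊆ Ω → MemLp g 2 (volume.restrict K)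
  integral_eq : ∀ φ : Eucl n → ℝ, ContDiff ℝ ∞ φ → HasCompactSupport φ → tsupport φ ⊆ Ω →
    ∀ i : Fin n,
      ∫ x in Ω, u x * fderiv ℝ φ x (EuclideanSpace.single i 1) = -∫ x in Ω, g x i * φ x

/-- The intrinsic distance `d_A(x, y)`: the supremum of `u(x) - u(y)` over all
`u ∈ C(Ω) ∩ W^{1,2}_loc(Ω)` with `H(z, ∇u(z)) ≤ 1` for almost every `z ∈ Ω`, as an element of
`[0, ∞]` (constants are admissible, so cutting negative differences off at `0` changes nothing). -/
def intrinsicDist {n : ℕ} (Ω : Set (Eucl n)) (A : Eucl n → Matrix (Fin n) (Fin n) ℝ)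
    (x y : Eucl n) : ℝ≥0∞ :=
  ⨆ (u : Eucl n → ℝ) (g : Eucl n → Eucl n) (_ : ContinuousOn u Ω)
    (_ : HasSobolevGradient Ω u g)
    (_ : ∀ᵐ z ∂(volume.restrict Ω), hamiltonian A z (g z) ≤ 1), ENNReal.ofReal (u x - u y)

/-- The pointwise Lipschitz constant
`Lip_{d_A} u(x) = limsup_{y → x} |u(y) - u(x)| / d_A(x, y)`, with `x ≠ y ∈ Ω`, in `[0, ∞]`. -/
def pointwiseLip {n : ℕ} (Ω : Set (Eucl n)) (A : Eucl n → Matrix (Fin n) (Fin n) ℝ)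
    (u : Eucl n → ℝ) (x : Eucl n) : ℝ≥0∞ :=
  limsup (fun y => ENNReal.ofReal |u y - u x| / intrinsicDist Ω A x y) (𝓝[Ω \ {x}] x)

end IntrinsicDistance

end

/-! At almost every `x` three things hold: `u` has a gradient `p` (Rademacher), `x` is a Lebesgue
point of the symmetric part `S` of `A`, and upper semicontinuity holds at `x` for every vector of a
countable dense set. Put `c = √H(x, p)`. At such a point `Lip u(x) = c` follows from two first-order
estimates of the distance.

Lower bound for Lip (`le_pointwiseLip`): move along `S(x) p`, the direction in which Cauchy–Schwarz
is sharp. There `u` grows at rate `⟨p, S(x) p⟩ = c²`. An admissible `v` satisfies `|⟨∇v, S(x) p⟩| ≤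
c + C |S - S(x)|` almost everywhere. A weak gradient cannot be integrated along a segment, so `v` is
mollified at a scale proportional to the length `t` of the segment, and the error becomes an average
of `|S - S(x)|`, which vanishes at a Lebesgue point. Hence `d_A ≤ t (c + ε)`
(`eventually_intrinsicDist_le`). Semicontinuity plays no role here.

Upper bound for Lip (`pointwiseLip_le`): semicontinuity gives `H(·, q) ≤ κ < 1` near `x` for some
`q` close to a multiple of `p`. A bounded, cut-off version of `⟨q, · - x⟩` is then admissible, so
`d_A(x, y) ≥ |⟨q, y - x⟩| - ε |y - x|`. The remaining `o(|y - x|)` terms are absorbed because `d_A`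
locally dominates the Euclidean distance. -/

namespace IntrinsicDistance

/-! ### The quadratic form and its symmetric part -/

section Algebra

variable {n : ℕ}

/-- The entries of the symmetric part of `A`. -/
noncomputable def symEntry (A : Eucl n → Matrix (Fin n) (Fin n) ℝ) (i j : Fin n) (x : Eucl n) : ℝ :=
  (A x i j + A x j i) / 2

/-- The symmetric part of `A x`, applied to a vector. -/
noncomputable def symApply (A : Eucl n → Matrix (Fin n) (Fin n) ℝ) (x p : Eucl n) : Eucl n :=
  WithLp.toLp 2 fun i => ∑ j, symEntry A i j x * p j

lemma symEntry_comm (A : Eucl n → Matrix (Fin n) (Fin n) ℝ) (i j : Fin n) (x : Eucl n) :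
    symEntry A i j x = symEntry A j i x := by
  simp [symEntry, add_comm]

lemma inner_symApply (A : Eucl n → Matrix (Fin n) (Fin n) ℝ) (x a b : Eucl n) :
    inner ℝ a (symApply A x b) = ∑ i, ∑ j, a i * symEntry A i j x * b j := by
  simp only [symApply, PiLp.inner_apply, RCLike.inner_apply, conj_trivial, Finset.sum_mul]
  exact Finset.sum_congr rfl fun i _ => Finset.sum_congr rfl fun j _ => by ring

lemma inner_symApply_comm (A : Eucl n → Matrix (Fin n) (Fin n) ℝ) (x a b : Eucl n) :
    inner ℝ a (symApply A x b) = inner ℝ b (symApply A x a) := by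
  rw [inner_symApply, inner_symApply, Finset.sum_comm]
  exact Finset.sum_congr rfl fun i _ => Finset.sum_congr rfl fun j _ => by
    rw [symEntry_comm]; ring

lemma inner_symApply_self (A : Eucl n → Matrix (Fin n) (Fin n) ℝ) (x a : Eucl n) :
    inner ℝ a (symApply A x a) = hamiltonian A x a := by
  rw [inner_symApply, hamiltonian]
  have h : ∑ i, ∑ j, a i * A x i j * a j = ∑ i, ∑ j, a i * A x j i * a j := by
    rw [Finset.sum_comm]
    exact Finset.sum_congr rfl fun i _ => Finset.sum_congr rfl fun j _ => by ring
  have h2 : ∑ i, ∑ j, a i * symEntry A i j x * a j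
      = (∑ i, ∑ j, a i * A x i j * a j + ∑ i, ∑ j, a i * A x j i * a j) / 2 := by
    simp only [← Finset.sum_add_distrib, Finset.sum_div, symEntry]
    exact Finset.sum_congr rfl fun i _ => Finset.sum_congr rfl fun j _ => by ring
  rw [h2, ← h]; ring

lemma symApply_add (A : Eucl n → Matrix (Fin n) (Fin n) ℝ) (x a b : Eucl n) :
    symApply A x (a + b) = symApply A x a + symApply A x b := by
  ext i
  simp [symApply, mul_add, Finset.sum_add_distrib]

lemma symApply_smul (A : Eucl n → Matrix (Fin n) (Fin n) ℝ) (x a : Eucl n) (c : ℝ) :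
    symApply A x (c • a) = c • symApply A x a := by
  ext i
  simp only [symApply, PiLp.smul_apply, smul_eq_mul, Finset.mul_sum]
  exact Finset.sum_congr rfl fun j _ => by ring

lemma hamiltonian_smul (A : Eucl n → Matrix (Fin n) (Fin n) ℝ) (x a : Eucl n) (c : ℝ) :
    hamiltonian A x (c • a) = c ^ 2 * hamiltonian A x a := by
  simp only [← inner_symApply_self, symApply_smul, inner_smul_left, inner_smul_right, conj_trivial]
  ring

lemma hamiltonian_zero (A : Eucl n → Matrix (Fin n) (Fin n) ℝ) (x : Eucl n) :
    hamiltonian A x 0 = 0 := by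
  simp [hamiltonian]

lemma hamiltonian_add (A : Eucl n → Matrix (Fin n) (Fin n) ℝ) (x a b : Eucl n) :
    hamiltonian A x (a + b)
      = hamiltonian A x a + 2 * inner ℝ a (symApply A x b) + hamiltonian A x b := by
  simp only [← inner_symApply_self, symApply_add, inner_add_left, inner_add_right]
  rw [inner_symApply_comm A x b a]; ring

/-- Expand the nonnegative number `H(c a ∓ b)` and divide by `c`. This is Cauchy–Schwarz for the
symmetric part in Young form; the weight stays free so that each use can balance the two terms. -/
lemma two_mul_abs_inner_symApply_le {A : Eucl n → Matrix (Fin n) (Fin n) ℝ} {x : Eucl n}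
    (h : ∀ ξ, 0 ≤ hamiltonian A x ξ) (a b : Eucl n) {c : ℝ} (hc : 0 < c) :
    2 * |inner ℝ a (symApply A x b)| ≤ c * hamiltonian A x a + c⁻¹ * hamiltonian A x b := by
  have key : ∀ s : ℝ, s ^ 2 = 1 → 2 * (s * inner ℝ a (symApply A x b))
      ≤ c * hamiltonian A x a + c⁻¹ * hamiltonian A x b := by
    intro s hs
    have h1 := h (c • a + (-s) • b)
    rw [hamiltonian_add, hamiltonian_smul, hamiltonian_smul, symApply_smul, inner_smul_left,
      inner_smul_right, conj_trivial, neg_sq, hs] at h1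
    have h2 := mul_nonneg (inv_pos.2 hc).le h1
    have h3 : c⁻¹ * (c ^ 2 * hamiltonian A x a + 2 * (c * (-s * inner ℝ a (symApply A x b)))
        + 1 * hamiltonian A x b) = c * hamiltonian A x a
          - 2 * (s * inner ℝ a (symApply A x b)) + c⁻¹ * hamiltonian A x b := by
      field_simp; ring
    linarith
  rcases abs_choice (inner ℝ a (symApply A x b)) with h | h <;> rw [h]
  · simpa using key 1 (by norm_num)
  · simpa using key (-1) (by norm_num)

lemma hamiltonian_add_le {A : Eucl n → Matrix (Fin n) (Fin n) ℝ} {x : Eucl n}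
    (h : ∀ ξ, 0 ≤ hamiltonian A x ξ) (a b : Eucl n) {c : ℝ} (hc : 0 < c) :
    hamiltonian A x (a + b)
      ≤ (1 + c) * hamiltonian A x a + (1 + c⁻¹) * hamiltonian A x b := by
  have h1 := two_mul_abs_inner_symApply_le h a b hc
  rw [hamiltonian_add]
  linarith [le_abs_self (inner ℝ a (symApply A x b))]

lemma continuous_hamiltonian (A : Eucl n → Matrix (Fin n) (Fin n) ℝ) (x : Eucl n) :
    Continuous (hamiltonian A x) := by
  unfold hamiltonian
  fun_prop

/-- The `ℓ¹`-distance of the symmetric parts of `A y` and `A x`. -/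
noncomputable def oscEntries (A : Eucl n → Matrix (Fin n) (Fin n) ℝ) (x y : Eucl n) : ℝ :=
  ∑ i, ∑ j, |symEntry A i j y - symEntry A i j x|

lemma oscEntries_nonneg (A : Eucl n → Matrix (Fin n) (Fin n) ℝ) (x y : Eucl n) :
    0 ≤ oscEntries A x y :=
  Finset.sum_nonneg fun _ _ => Finset.sum_nonneg fun _ _ => abs_nonneg _

lemma abs_inner_symApply_sub_le (A : Eucl n → Matrix (Fin n) (Fin n) ℝ) (x y a b : Eucl n) :
    |inner ℝ a (symApply A y b) - inner ℝ a (symApply A x b)|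
      ≤ ‖a‖ * ‖b‖ * oscEntries A x y := by
  simp only [inner_symApply, ← Finset.sum_sub_distrib, oscEntries, Finset.mul_sum]
  refine (Finset.abs_sum_le_sum_abs _ _).trans (Finset.sum_le_sum fun i _ => ?_)
  refine (Finset.abs_sum_le_sum_abs _ _).trans (Finset.sum_le_sum fun j _ => ?_)
  rw [show a i * symEntry A i j y * b j - a i * symEntry A i j x * b j
    = (a i * b j) * (symEntry A i j y - symEntry A i j x) by ring, abs_mul, abs_mul]
  have h1 : |a i| ≤ ‖a‖ := PiLp.norm_apply_le a i
  have h2 : |b j| ≤ ‖b‖ := PiLp.norm_apply_le b j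
  gcongr

lemma abs_hamiltonian_sub_le (A : Eucl n → Matrix (Fin n) (Fin n) ℝ) (x y a : Eucl n) :
    |hamiltonian A y a - hamiltonian A x a| ≤ ‖a‖ ^ 2 * oscEntries A x y := by
  have := abs_inner_symApply_sub_le A x y a a
  rwa [inner_symApply_self, inner_symApply_self, ← sq] at this

/-- The derivative of an admissible function in the direction `S(x) p` is almost bounded by
`√H(x, p)` wherever the symmetric part `S` of `A` is close to `S(x)`. -/
lemma abs_inner_symApply_le_of_hamiltonian_le_one {A : Eucl n → Matrix (Fin n) (Fin n) ℝ}
    {x y g p : Eucl n} {c L : ℝ} (h : ∀ ξ, 0 ≤ hamiltonian A y ξ) (hg : hamiltonian A y g ≤ 1)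
    (hgL : ‖g‖ ≤ L) (hc : 0 < c) (hcp : hamiltonian A x p = c ^ 2) :
    |inner ℝ g (symApply A x p)|
      ≤ c + (‖p‖ ^ 2 / (2 * c) + L * ‖p‖) * oscEntries A x y := by
  -- The weight `c = √H(x, p)` is the balanced one: `c * H(y, g) ≤ c`, and `c⁻¹ * H(x, p) = c`.
  have h1 := two_mul_abs_inner_symApply_le h g p hc
  have h2 := (abs_le.1 (abs_hamiltonian_sub_le A x y p)).2
  have h3 := abs_inner_symApply_sub_le A x y g p
  have h4 : ‖g‖ * ‖p‖ * oscEntries A x y ≤ L * ‖p‖ * oscEntries A x y := by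
    have := oscEntries_nonneg A x y
    gcongr
  have h5 : c⁻¹ * hamiltonian A y p ≤ c + ‖p‖ ^ 2 / c * oscEntries A x y := by
    have : hamiltonian A y p ≤ c ^ 2 + ‖p‖ ^ 2 * oscEntries A x y := by linarith
    calc c⁻¹ * hamiltonian A y p ≤ c⁻¹ * (c ^ 2 + ‖p‖ ^ 2 * oscEntries A x y) := by gcongr
      _ = _ := by field_simp
  have h6 : c * hamiltonian A y g ≤ c := by nlinarith
  have h7 := abs_sub_abs_le_abs_sub (inner ℝ g (symApply A x p)) (inner ℝ g (symApply A y p))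
  rw [abs_sub_comm] at h7
  have h8 : (‖p‖ ^ 2 / (2 * c) + L * ‖p‖) * oscEntries A x y
      = (‖p‖ ^ 2 / c * oscEntries A x y) / 2 + L * ‖p‖ * oscEntries A x y := by
    field_simp
  rw [h8]
  linarith

end Algebra

/-! ### Mollification of functions with a weak gradient -/

section Mollification

variable {n : ℕ}

lemma integrable_mul_of_memLp_of_support_subset {f ψ : Eucl n → ℝ} {K : Set (Eucl n)}
    (hK : IsCompact K) (hf : MemLp f 2 (volume.restrict K)) (hψ : Continuous ψ)
    (hs : Function.support ψ ⊆ K) : Integrable (fun x => f x * ψ x) := by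
  have : IsFiniteMeasure (volume.restrict K) := ⟨by simpa using hK.measure_lt_top⟩
  have h1 : IntegrableOn f K := hf.integrable (by norm_num)
  have h2 : IntegrableOn (fun x => f x * ψ x) K := h1.mul_continuousOn hψ.continuousOn hK
  refine (integrableOn_iff_integrable_of_support_subset ?_).1 h2
  exact (Function.support_mul_subset_right f ψ).trans hs

lemma HasSobolevGradient.integrable_inner_mul {Ω : Set (Eucl n)} {v : Eucl n → ℝ}
    {g : Eucl n → Eucl n} (h : HasSobolevGradient Ω v g) (e : Eucl n) {φ : Eucl n → ℝ}
    (hφ : Continuous φ) (hc : HasCompactSupport φ) (hs : tsupport φ ⊆ Ω) :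
    Integrable (fun x => inner ℝ (g x) e * φ x) := by
  refine integrable_mul_of_memLp_of_support_subset (f := fun x => inner ℝ (g x) e) hc ?_ hφ
    (subset_tsupport φ)
  exact (h.memLp_grad _ hc hs).inner_const e

/-- The defining identity of the weak gradient, in an arbitrary direction. -/
lemma HasSobolevGradient.integral_fderiv_apply {Ω : Set (Eucl n)} {v : Eucl n → ℝ}
    {g : Eucl n → Eucl n} (h : HasSobolevGradient Ω v g) (e : Eucl n) {φ : Eucl n → ℝ}
    (hφ : ContDiff ℝ ∞ φ) (hc : HasCompactSupport φ) (hs : tsupport φ ⊆ Ω) :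
    ∫ x in Ω, v x * fderiv ℝ φ x e = -∫ x in Ω, inner ℝ (g x) e * φ x := by
  have he : e = ∑ i, e i • EuclideanSpace.single i (1 : ℝ) := by
    ext j
    simp [Finset.sum_apply, Pi.single_apply]
  have hv (i : Fin n) : Integrable
      (fun x => v x * fderiv ℝ φ x (EuclideanSpace.single i 1)) (volume.restrict Ω) := by
    refine (integrable_mul_of_memLp_of_support_subset hc (h.memLp_fun _ hc hs)
      ((hφ.continuous_fderiv (by simp)).clm_apply continuous_const) ?_).integrableOn
    intro x hx
    refine support_fderiv_subset ℝ (f := φ) ?_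
    rw [Function.mem_support] at hx ⊢
    intro h0
    exact hx (by simp [h0])
  have hg (i : Fin n) : Integrable (fun x => g x i * φ x) (volume.restrict Ω) := by
    have := (h.integrable_inner_mul (EuclideanSpace.single i 1) hφ.continuous hc hs).integrableOn
      (s := Ω)
    simpa [EuclideanSpace.inner_single_right, IntegrableOn] using this
  have h1 : ∀ x, v x * fderiv ℝ φ x e
      = ∑ i, e i * (v x * fderiv ℝ φ x (EuclideanSpace.single i 1)) := by
    intro x
    conv_lhs => rw [he]
    simp only [map_sum, map_smul, smul_eq_mul, Finset.mul_sum]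
    exact Finset.sum_congr rfl fun i _ => by ring
  have h2 : ∀ x, inner ℝ (g x) e * φ x = ∑ i, e i * (g x i * φ x) := by
    intro x
    simp only [PiLp.inner_apply, RCLike.inner_apply, conj_trivial, Finset.sum_mul]
    exact Finset.sum_congr rfl fun i _ => by ring
  simp only [h1, h2]
  rw [integral_finsetSum _ fun i _ => (hv i).const_mul _,
    integral_finsetSum _ fun i _ => (hg i).const_mul _, ← Finset.sum_neg_distrib]
  refine Finset.sum_congr rfl fun i _ => ?_
  rw [integral_const_mul, integral_const_mul, h.integral_eq φ hφ hc hs i, mul_neg]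

open Convolution in
/-- The mollification of `v` on the ball `closedBall x R`. -/
noncomputable def mollify (η : ContDiffBump (0 : Eucl n)) (x : Eucl n) (R : ℝ) (v : Eucl n → ℝ) :
    Eucl n → ℝ :=
  η.normed volume ⋆[ContinuousLinearMap.lsmul ℝ ℝ, volume] ((Metric.closedBall x R).indicator v)

/-- The derivative falls on the kernel. The condition on `z` keeps the support of `w ↦ η(z - w)`
inside the ball, so this is a legitimate test function and the truncation of `v` to the ball is not
felt. The sign from differentiating in `w` cancels the one in the weak-gradient identity. -/
lemma hasFDerivAt_mollify {Ω : Set (Eucl n)} {v : Eucl n → ℝ} {g : Eucl n → Eucl n}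
    (hvc : ContinuousOn v Ω) (h : HasSobolevGradient Ω v g) {x : Eucl n} {R : ℝ}
    (hR : Metric.closedBall x R ⊆ Ω) (η : ContDiffBump (0 : Eucl n)) {z : Eucl n}
    (hz : dist z x + η.rOut ≤ R) :
    ∃ D : Eucl n →L[ℝ] ℝ, HasFDerivAt (mollify η x R v) D z ∧
      ∀ e, D e = ∫ w in Ω, inner ℝ (g w) e * η.normed volume (z - w) := by
  have hK : IsCompact (Metric.closedBall x R) := isCompact_closedBall x R
  have hVi : Integrable ((Metric.closedBall x R).indicator v) :=
    (integrable_indicator_iff Metric.isClosed_closedBall.measurableSet).2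
      ((hvc.mono hR).integrableOn_compact hK)
  have hηc : HasCompactSupport (η.normed volume) := η.hasCompactSupport_normed
  have hηs : ContDiff ℝ ∞ (η.normed volume) := η.contDiff_normed
  refine ⟨_, hηc.hasFDerivAt_convolution_left (ContinuousLinearMap.lsmul ℝ ℝ)
    (hηs.of_le (by simp)) hVi.locallyIntegrable z, fun e => ?_⟩
  have hex := (hηc.fderiv ℝ).convolutionExists_left
    (ContinuousLinearMap.precompL (Eucl n) (ContinuousLinearMap.lsmul ℝ ℝ))
    (hηs.continuous_fderiv (by simp)) hVi.locallyIntegrable z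
  set φ : Eucl n → ℝ := fun w => η.normed volume (z - w) with hφ
  have hφs : ContDiff ℝ ∞ φ := hηs.comp (contDiff_const.sub contDiff_id)
  have hφsupp : tsupport φ ⊆ Metric.closedBall x R := by
    refine closure_minimal ?_ Metric.isClosed_closedBall
    intro w hw
    have h1 : z - w ∈ Function.support (η.normed volume) := hw
    rw [η.support_normed_eq, mem_ball_zero_iff] at h1
    rw [Metric.mem_closedBall]
    have := dist_triangle w z x
    rw [dist_comm w z, dist_eq_norm z w] at this
    linarith
  have hφc : HasCompactSupport φ := hK.of_isClosed_subset (isClosed_tsupport φ) hφsupp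
  have hφd : ∀ w, fderiv ℝ φ w e = - fderiv ℝ (η.normed volume) (z - w) e := by
    intro w
    have h1 : HasFDerivAt φ ((fderiv ℝ (η.normed volume) (z - w)).comp
        (-ContinuousLinearMap.id ℝ (Eucl n))) w := by
      have h2 : HasFDerivAt (fun w => z - w) (-ContinuousLinearMap.id ℝ (Eucl n)) w := by
        simpa using (hasFDerivAt_id w).const_sub z
      exact HasFDerivAt.comp w (hηs.differentiable (by simp) (z - w)).hasFDerivAt h2
    rw [h1.fderiv]
    simp
  have key := h.integral_fderiv_apply e hφs hφc (hφsupp.trans hR)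
  rw [convolution_def, ContinuousLinearMap.integral_apply hex]
  rw [← neg_eq_iff_eq_neg] at key
  rw [← key, ← integral_neg,
    setIntegral_eq_integral_of_forall_compl_eq_zero (s := Ω) (f := fun w => -(v w * fderiv ℝ φ w e)),
    ← integral_sub_left_eq_self _ volume z]
  · refine integral_congr_ae (Eventually.of_forall fun w => ?_)
    simp only [sub_sub_cancel, hφd]
    by_cases hw : w ∈ Metric.closedBall x R
    · rw [indicator_of_mem hw]
      simp [mul_comm]
    · rw [indicator_of_notMem hw]
      have h0 : fderiv ℝ φ w = 0 := by
        by_contra h0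
        exact hw (hφsupp (support_fderiv_subset ℝ (f := φ) h0))
      have := hφd w
      rw [h0] at this
      simp at this
      simp [← this]
  · intro w hw
    have h0 : fderiv ℝ φ w = 0 := by
      by_contra h0
      exact hw (hR (hφsupp (support_fderiv_subset ℝ h0)))
    simp [h0]

/-- The kernel has mass one, which handles the constant `a`, and is at most the inverse volume of
its inner ball, which handles `Δ`. -/
lemma abs_mollify_deriv_le {Ω : Set (Eucl n)} {g : Eucl n → Eucl n}
    (hΩ : MeasurableSet Ω) {x : Eucl n} {R : ℝ}
    (hR : Metric.closedBall x R ⊆ Ω) (η : ContDiffBump (0 : Eucl n)) {z e : Eucl n}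
    (hz : dist z x + η.rOut ≤ R) {a : ℝ} {Δ : Eucl n → ℝ}
    (hΔ : ∀ w, 0 ≤ Δ w) (hΔi : IntegrableOn Δ (Metric.closedBall x R))
    (hg : ∀ᵐ w ∂(volume.restrict (Metric.closedBall x R)), |inner ℝ (g w) e| ≤ a + Δ w) :
    |∫ w in Ω, inner ℝ (g w) e * η.normed volume (z - w)|
      ≤ a + (∫ w in Metric.closedBall x R, Δ w)
        / volume.real (Metric.closedBall (0 : Eucl n) η.rIn) := by
  set K := Metric.closedBall x R with hK
  set M := volume.real (Metric.closedBall (0 : Eucl n) η.rIn) with hM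
  have hKm : MeasurableSet K := Metric.isClosed_closedBall.measurableSet
  set φ : Eucl n → ℝ := fun w => η.normed volume (z - w) with hφ
  have hφcont : Continuous φ := η.continuous_normed.comp (continuous_const.sub continuous_id)
  have hφ0 : ∀ w, 0 ≤ φ w := fun w => η.nonneg_normed _
  have hφM : ∀ w, φ w ≤ 1 / M := fun w => η.normed_le_div_measure_closedBall_rIn volume _
  have hsupp : ∀ w, w ∉ K → φ w = 0 := by
    intro w hw
    by_contra h0
    have h1 : z - w ∈ Function.support (η.normed volume) := h0
    rw [η.support_normed_eq, mem_ball_zero_iff] at h1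
    apply hw
    rw [hK, Metric.mem_closedBall]
    have := dist_triangle w z x
    rw [dist_comm w z, dist_eq_norm z w] at this
    linarith
  have hφint : Integrable φ := by
    refine hφcont.integrable_of_hasCompactSupport ?_
    exact HasCompactSupport.intro (isCompact_closedBall x R) hsupp
  have hint1 : ∫ w in K, φ w = 1 := by
    rw [setIntegral_eq_integral_of_forall_compl_eq_zero hsupp]
    rw [integral_sub_left_eq_self (fun w => η.normed volume w) volume z]
    exact η.integral_normed
  have hΩK : ∫ w in Ω, inner ℝ (g w) e * φ w = ∫ w in K, inner ℝ (g w) e * φ w := by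
    rw [setIntegral_eq_of_subset_of_forall_sdiff_eq_zero hΩ hR]
    intro w hw
    simp [hsupp w hw.2]
  rw [hΩK, ← Real.norm_eq_abs]
  have hi : IntegrableOn (fun w => a * φ w + Δ w / M) K :=
    (hφint.integrableOn.const_mul a).add (hΔi.div_const M)
  refine (norm_integral_le_of_norm_le hi ?_).trans ?_
  · filter_upwards [hg] with w hw
    rw [norm_mul, Real.norm_eq_abs, Real.norm_eq_abs, abs_of_nonneg (hφ0 w)]
    calc |inner ℝ (g w) e| * φ w ≤ (a + Δ w) * φ w := by gcongr; exact hφ0 w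
      _ = a * φ w + Δ w * φ w := by ring
      _ ≤ a * φ w + Δ w * (1 / M) := by gcongr; exacts [hΔ w, hφM w]
      _ = _ := by ring
  · rw [integral_add (hφint.integrableOn.const_mul a) (hΔi.div_const M), integral_const_mul, hint1,
      integral_div, mul_one]

/-- A bound for the increments of a mollified function along a segment. -/
lemma abs_mollify_sub_le {Ω : Set (Eucl n)} {v : Eucl n → ℝ} {g : Eucl n → Eucl n}
    (hΩ : MeasurableSet Ω) (hvc : ContinuousOn v Ω)
    (h : HasSobolevGradient Ω v g) {x : Eucl n} {R : ℝ}
    (hR : Metric.closedBall x R ⊆ Ω) (η : ContDiffBump (0 : Eucl n)) {y e : Eucl n} {t : ℝ}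
    (ht : 0 ≤ t) (hy : dist y x + η.rOut ≤ R) (hyt : dist (y + t • e) x + η.rOut ≤ R)
    {a : ℝ} {Δ : Eucl n → ℝ}
    (hΔ : ∀ w, 0 ≤ Δ w) (hΔi : IntegrableOn Δ (Metric.closedBall x R))
    (hg : ∀ᵐ w ∂(volume.restrict (Metric.closedBall x R)), |inner ℝ (g w) e| ≤ a + Δ w) :
    |mollify η x R v (y + t • e) - mollify η x R v y|
      ≤ (a + (∫ w in Metric.closedBall x R, Δ w)
        / volume.real (Metric.closedBall (0 : Eucl n) η.rIn)) * t := by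
  have hseg : ∀ s ∈ Icc 0 t, dist (y + s • e) x + η.rOut ≤ R := by
    intro s hs
    have hconv := convex_closedBall x (R - η.rOut)
    have hL : Convex ℝ ((fun s : ℝ => y + s • e) ⁻¹' Metric.closedBall x (R - η.rOut)) := by
      have : (fun s : ℝ => y + s • e) = AffineMap.lineMap y (y + e) := by
        ext s : 1
        simp [AffineMap.lineMap_apply, add_comm]
      rw [this]
      exact hconv.affine_preimage _
    have h0 : (0 : ℝ) ∈ (fun s : ℝ => y + s • e) ⁻¹' Metric.closedBall x (R - η.rOut) := by
      simp only [mem_preimage, zero_smul, add_zero, Metric.mem_closedBall]; linarith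
    have h1 : t ∈ (fun s : ℝ => y + s • e) ⁻¹' Metric.closedBall x (R - η.rOut) := by
      simp only [mem_preimage, Metric.mem_closedBall]; linarith
    have := hL.ordConnected.out h0 h1 hs
    simp only [mem_preimage, Metric.mem_closedBall] at this
    linarith
  have hder : ∀ s ∈ Icc 0 t, HasDerivWithinAt (fun s : ℝ => mollify η x R v (y + s • e))
      (∫ w in Ω, inner ℝ (g w) e * η.normed volume (y + s • e - w)) (Icc 0 t) s := by
    intro s hs
    obtain ⟨D, hD, hDe⟩ := hasFDerivAt_mollify hvc h hR η (hseg s hs)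
    rw [← hDe e]
    have h1 : HasDerivAt (fun s : ℝ => y + s • e) e s := by
      simpa using ((hasDerivAt_id s).smul_const e).const_add y
    exact (hD.comp_hasDerivAt s h1).hasDerivWithinAt
  have := (convex_Icc (0 : ℝ) t).norm_image_sub_le_of_norm_hasDerivWithin_le hder
    (fun s hs => abs_mollify_deriv_le hΩ hR η (hseg s hs) hΔ hΔi hg)
    (left_mem_Icc.2 ht) (right_mem_Icc.2 ht)
  simpa [abs_of_nonneg ht] using this

lemma abs_mollify_sub_self_le {v : Eucl n → ℝ} {x : Eucl n} {R : ℝ}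
    (hv : ContinuousOn v (Metric.closedBall x R)) (η : ContDiffBump (0 : Eucl n)) {z : Eucl n}
    (hz : dist z x + η.rOut ≤ R) {ε : ℝ}
    (hε : ∀ w ∈ Metric.ball z η.rOut, |v w - v z| ≤ ε) : |mollify η x R v z - v z| ≤ ε := by
  have hmem : ∀ w ∈ Metric.ball z η.rOut, w ∈ Metric.closedBall x R := by
    intro w hw
    rw [Metric.mem_ball] at hw
    rw [Metric.mem_closedBall]
    linarith [dist_triangle w z x]
  have hzR := hmem z (Metric.mem_ball_self η.rOut_pos)
  have h1 : AEStronglyMeasurable ((Metric.closedBall x R).indicator v) volume :=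
    (aestronglyMeasurable_indicator_iff Metric.isClosed_closedBall.measurableSet).2
      (hv.aestronglyMeasurable Metric.isClosed_closedBall.measurableSet)
  have := ContDiffBump.dist_normed_convolution_le (φ := η) (x₀ := z) (ε := ε) h1 (by
    intro w hw
    rw [indicator_of_mem (hmem w hw), indicator_of_mem hzR]
    exact hε w hw)
  rwa [indicator_of_mem hzR] at this

/-- A continuous function with bounded weak gradient is locally Lipschitz. -/
lemma HasSobolevGradient.abs_sub_le {Ω : Set (Eucl n)} {v : Eucl n → ℝ} {g : Eucl n → Eucl n}
    (hΩ : MeasurableSet Ω) (hvc : ContinuousOn v Ω)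
    (h : HasSobolevGradient Ω v g) {x : Eucl n} {R : ℝ}
    (hR : Metric.closedBall x R ⊆ Ω) {L : ℝ}
    (hg : ∀ᵐ w ∂(volume.restrict (Metric.closedBall x R)), ‖g w‖ ≤ L) {y z : Eucl n}
    (hy : y ∈ Metric.ball x R) (hz : z ∈ Metric.ball x R) : |v z - v y| ≤ L * ‖z - y‖ := by
  have hvR := hvc.mono hR
  refine le_of_forall_pos_le_add fun ε hε => ?_
  have hcont : ∀ p ∈ Metric.ball x R, ∃ ρ > 0, dist p x + ρ ≤ R ∧
      ∀ w ∈ Metric.ball p ρ, |v w - v p| ≤ ε / 2 := by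
    intro p hp
    have h1 : ContinuousAt v p :=
      hvR.continuousAt (mem_of_superset (Metric.isOpen_ball.mem_nhds hp) Metric.ball_subset_closedBall)
    obtain ⟨δ, hδ, hδ'⟩ := Metric.continuousAt_iff.1 h1 (ε / 2) (half_pos hε)
    rw [Metric.mem_ball] at hp
    refine ⟨min δ (R - dist p x), lt_min hδ (by linarith), ?_, ?_⟩
    · linarith [min_le_right δ (R - dist p x)]
    · intro w hw
      exact (hδ' (lt_of_lt_of_le (Metric.mem_ball.1 hw) (min_le_left _ _))).le
  obtain ⟨ρ₁, h1, h1', h1''⟩ := hcont y hy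
  obtain ⟨ρ₂, h2, h2', h2''⟩ := hcont z hz
  set ρ := min ρ₁ ρ₂ with hρ
  have hρ0 : 0 < ρ := lt_min h1 h2
  let η : ContDiffBump (0 : Eucl n) := ⟨ρ / 2, ρ, half_pos hρ0, half_lt_self hρ0⟩
  have hr : η.rOut = ρ := rfl
  have e1 : dist y x + η.rOut ≤ R := by rw [hr]; linarith [min_le_left ρ₁ ρ₂]
  have e2 : dist z x + η.rOut ≤ R := by rw [hr]; linarith [min_le_right ρ₁ ρ₂]
  have a1 := abs_mollify_sub_self_le hvR η e1 (ε := ε / 2) fun w hw =>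
    h1'' w (Metric.ball_subset_ball (min_le_left _ _) hw)
  have a2 := abs_mollify_sub_self_le hvR η e2 (ε := ε / 2) fun w hw =>
    h2'' w (Metric.ball_subset_ball (min_le_right _ _) hw)
  -- With `Δ = 0` the bound does not depend on the mollification radius, so only the two endpoint
  -- errors `ε / 2` remain.
  have a3 := abs_mollify_sub_le hΩ hvc h hR η (y := y) (e := z - y) (t := 1) zero_le_one e1
    (by simpa using e2) (a := L * ‖z - y‖) (Δ := fun _ => 0) (fun _ => le_rfl) (by simp) (by
      filter_upwards [hg] with w hw
      rw [add_zero]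
      exact (abs_real_inner_le_norm _ _).trans (by gcongr))
  simp only [one_smul, add_sub_cancel, integral_zero, zero_div, add_zero, mul_one] at a3
  rw [abs_le] at *
  constructor <;> linarith [a1.1, a1.2, a2.1, a2.2, a3.1, a3.2]

end Mollification

/-! ### Lebesgue points and the upper bound for the distance -/

section UpperBoundOfDistance

variable {n : ℕ} {Ω : Set (Eucl n)} {A : Eucl n → Matrix (Fin n) (Fin n) ℝ}

lemma IsDiffusionMatrix.exists_closedBall_bound (hΩ : IsOpen Ω) (hA : IsDiffusionMatrix Ω A)
    {x : Eucl n} (hx : x ∈ Ω) :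
    ∃ R > 0, ∃ Λ ≥ (1 : ℝ), Metric.closedBall x R ⊆ Ω ∧
      ∀ᵐ w ∂(volume.restrict (Metric.closedBall x R)), ∀ ξ : Eucl n,
        Λ⁻¹ * ‖ξ‖ ^ 2 ≤ hamiltonian A w ξ ∧ hamiltonian A w ξ ≤ Λ * ‖ξ‖ ^ 2 := by
  obtain ⟨lam, hlc, hl1, hle⟩ := hA.elliptic
  have h1 : ∀ᶠ y in 𝓝 x, y ∈ Ω ∧ lam y < lam x + 1 :=
    (hΩ.eventually_mem hx).and
      ((hlc.continuousAt (hΩ.mem_nhds hx)).eventually_lt continuousAt_const (by linarith))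
  obtain ⟨R, hR, hRs⟩ := Metric.nhds_basis_closedBall.eventually_iff.1 h1
  refine ⟨R, hR, lam x + 1, by linarith [hl1 x hx], fun y hy => (hRs hy).1, ?_⟩
  filter_upwards [ae_restrict_of_ae_restrict_of_subset (fun y hy => (hRs hy).1) hle,
    ae_restrict_mem Metric.isClosed_closedBall.measurableSet] with w hw hwm ξ
  have h2 := hRs hwm
  have h3 := hl1 w h2.1
  refine ⟨le_trans ?_ (hw ξ).1, (hw ξ).2.trans ?_⟩
  · gcongr
    exact h2.2.le
  · gcongr
    exact h2.2.le

/-- Young's inequality with weight one on two basis vectors. It makes the entries locally bounded,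
as Lebesgue differentiation requires. -/
lemma abs_symEntry_le {x : Eucl n} {Λ : ℝ} (h0 : ∀ ξ, 0 ≤ hamiltonian A x ξ)
    (h : ∀ ξ, hamiltonian A x ξ ≤ Λ * ‖ξ‖ ^ 2) (i j : Fin n) : |symEntry A i j x| ≤ Λ := by
  have h1 := two_mul_abs_inner_symApply_le h0 (EuclideanSpace.single i 1)
    (EuclideanSpace.single j 1) one_pos
  have h2 := h (EuclideanSpace.single i 1)
  have h3 := h (EuclideanSpace.single j 1)
  have h4 : inner ℝ (EuclideanSpace.single i 1) (symApply A x (EuclideanSpace.single j 1))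
      = symEntry A i j x := by
    simp [EuclideanSpace.inner_single_left, symApply]
  rw [h4] at h1
  simp at h1 h2 h3
  linarith

/-- Almost every point is a Lebesgue point of the symmetric part of a diffusion matrix. -/
lemma IsDiffusionMatrix.ae_tendsto_average_oscEntries (hΩ : IsOpen Ω)
    (hA : IsDiffusionMatrix Ω A) :
    ∀ᵐ x ∂(volume.restrict Ω), (∃ r > 0, IntegrableOn (oscEntries A x) (Metric.closedBall x r)) ∧
      Tendsto (fun r => ⨍ y in Metric.closedBall x r, oscEntries A x y) (𝓝[>] 0) (𝓝 0) := by
  obtain ⟨lam, hlc, hl1, hle⟩ := hA.elliptic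
  -- The sets `U N` form a countable open exhaustion of `Ω`. On `U N` the entries are bounded by
  -- `N`, so their extensions by zero are locally integrable on the whole space.
  set U : ℕ → Set (Eucl n) := fun N => Ω ∩ lam ⁻¹' Iio (N : ℝ) with hU
  have hUo : ∀ N, IsOpen (U N) := fun N => hlc.isOpen_inter_preimage hΩ isOpen_Iio
  set f : ℕ → Fin n → Fin n → Eucl n → ℝ := fun N i j => (U N).indicator (symEntry A i j) with hf
  have hbound : ∀ N i j, ∀ᵐ y, ‖f N i j y‖ ≤ N := by
    intro N i j
    filter_upwards [(ae_restrict_iff' hΩ.measurableSet).1 hle] with y hy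
    by_cases hyU : y ∈ U N
    · have h2 := hy hyU.1
      have h3 := hl1 y hyU.1
      rw [hf]
      simp only [indicator_of_mem hyU]
      refine (abs_symEntry_le (fun ξ => le_trans ?_ (h2 ξ).1) (fun ξ => (h2 ξ).2) i j).trans
        (le_of_lt hyU.2)
      positivity
    · simp [hf, indicator_of_notMem hyU]
  have hmeas : ∀ N i j, AEStronglyMeasurable (f N i j) := by
    intro N i j
    refine (aestronglyMeasurable_indicator_iff (hUo N).measurableSet).2 ?_
    have : AEMeasurable (symEntry A i j) (volume.restrict Ω) :=
      ((hA.measurable i j).add (hA.measurable j i)).div_const 2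
    exact (this.mono_measure (Measure.restrict_mono inter_subset_left le_rfl)).aestronglyMeasurable
  have hint : ∀ N i j x r, IntegrableOn (f N i j) (Metric.closedBall x r) := by
    intro N i j x r
    exact Measure.integrableOn_of_bounded (M := N) measure_closedBall_lt_top.ne (hmeas N i j)
      (ae_restrict_of_ae (hbound N i j))
  have hloc : ∀ N i j, LocallyIntegrable (f N i j) := fun N i j x =>
    ⟨Metric.closedBall x 1, Metric.closedBall_mem_nhds x one_pos, hint N i j x 1⟩
  have hleb : ∀ᵐ x, ∀ N i j, Tendsto
      (fun r => ⨍ y in Metric.closedBall x r, ‖f N i j y - f N i j x‖) (𝓝[>] 0) (𝓝 0) := by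
    refine ae_all_iff.2 fun N => ae_all_iff.2 fun i => ae_all_iff.2 fun j => ?_
    filter_upwards [IsUnifLocDoublingMeasure.ae_tendsto_average_norm_sub volume (hloc N i j) 1]
      with x hx
    refine hx (fun _ => x) (fun r => r) tendsto_id ?_
    filter_upwards [self_mem_nhdsWithin] with r hr
    rw [one_mul]
    exact Metric.mem_closedBall_self (le_of_lt hr)
  filter_upwards [ae_restrict_of_ae hleb, ae_restrict_mem hΩ.measurableSet] with x hx hxΩ
  obtain ⟨N, hN⟩ := exists_nat_gt (lam x)
  have hxU : x ∈ U N := ⟨hxΩ, hN⟩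
  obtain ⟨r₀, hr₀, hr₀U⟩ := Metric.nhds_basis_closedBall.mem_iff.1 ((hUo N).mem_nhds hxU)
  have heq : ∀ i j, ∀ y ∈ U N, f N i j y = symEntry A i j y := fun i j y hy => by
    simp [hf, indicator_of_mem hy]
  have hosc : ∀ y ∈ U N, oscEntries A x y = ∑ i, ∑ j, ‖f N i j y - f N i j x‖ := by
    intro y hy
    simp only [oscEntries, heq _ _ y hy, heq _ _ x hxU, Real.norm_eq_abs]
  have hi : ∀ i j r, IntegrableOn (fun y => ‖f N i j y - f N i j x‖) (Metric.closedBall x r) := by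
    intro i j r
    exact ((hint N i j x r).sub (integrableOn_const measure_closedBall_lt_top.ne)).norm
  constructor
  · refine ⟨r₀, hr₀, ?_⟩
    refine IntegrableOn.congr_fun (f := fun y => ∑ i, ∑ j, ‖f N i j y - f N i j x‖) ?_
      (fun y hy => (hosc y (hr₀U hy)).symm) Metric.isClosed_closedBall.measurableSet
    exact integrable_finsetSum _ fun i _ => integrable_finsetSum _ fun j _ => hi i j r₀
  · have hsum : Tendsto (fun r => ∑ i, ∑ j, ⨍ y in Metric.closedBall x r,
        ‖f N i j y - f N i j x‖) (𝓝[>] 0) (𝓝 0) := by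
      have := tendsto_finsetSum (Finset.univ : Finset (Fin n)) fun i _ =>
        tendsto_finsetSum (Finset.univ : Finset (Fin n)) fun j _ => hx N i j
      simpa using this
    refine hsum.congr' ?_
    filter_upwards [Ioo_mem_nhdsGT hr₀] with r hr
    rw [setAverage_eq, setIntegral_congr_fun Metric.isClosed_closedBall.measurableSet
      (fun y hy => hosc y (hr₀U (Metric.closedBall_subset_closedBall hr.2.le hy))),
      integral_finsetSum _ fun i _ => integrable_finsetSum _ fun j _ => hi i j r, smul_eq_mul,
      Finset.mul_sum]
    refine Finset.sum_congr rfl fun i _ => ?_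
    rw [integral_finsetSum _ fun j _ => hi i j r, Finset.mul_sum]
    exact Finset.sum_congr rfl fun j _ => by rw [setAverage_eq, smul_eq_mul]

/-- At a Lebesgue point `x`, the intrinsic distance in the direction `S(x) p` is at most
`√H(x, p)` to first order. -/
lemma IsDiffusionMatrix.eventually_intrinsicDist_le (hΩ : IsOpen Ω)
    (hA : IsDiffusionMatrix Ω A) {x : Eucl n} (hx : x ∈ Ω)
    (hint : ∃ r > 0, IntegrableOn (oscEntries A x) (Metric.closedBall x r))
    (hleb : Tendsto (fun r => ⨍ y in Metric.closedBall x r, oscEntries A x y) (𝓝[>] 0) (𝓝 0))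
    {p : Eucl n} {c : ℝ} (hc : 0 < c) (hcp : hamiltonian A x p = c ^ 2) {ε : ℝ} (hε : 0 < ε) :
    ∀ᶠ t in 𝓝[>] (0 : ℝ),
      intrinsicDist Ω A x (x + t • symApply A x p) ≤ ENNReal.ofReal (t * (c + ε)) := by
  obtain ⟨R₀, hR₀, Λ, hΛ, hR₀Ω, hell⟩ := hA.exists_closedBall_bound hΩ hx
  obtain ⟨r₀, hr₀, hr₀i⟩ := hint
  set L := Real.sqrt Λ with hL
  have hL0 : 0 ≤ L := Real.sqrt_nonneg _
  set e := symApply A x p with he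
  set C := ‖p‖ ^ 2 / (2 * c) + L * ‖p‖ with hC
  have hC0 : 0 ≤ C := by positivity
  -- Mollification will be at radius `δ t`: `δ ≤ 1` keeps it inside the ball of radius `t (‖e‖ +
  -- 1)`, and the second bound makes the two endpoint errors `L δ t` cost at most `ε t / 2`
  -- together.
  set δ := min 1 (ε / (4 * (L + 1))) with hδ
  have hδ0 : 0 < δ := lt_min one_pos (by positivity)
  have hδL : 2 * (L * δ) ≤ ε / 2 := by
    have h1 : δ ≤ ε / (4 * (L + 1)) := min_le_right _ _
    have h2 : (L + 1) * δ ≤ ε / 4 := by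
      calc (L + 1) * δ ≤ (L + 1) * (ε / (4 * (L + 1))) := by gcongr
        _ = ε / 4 := by field_simp
    nlinarith
  -- Volume ratio of the ball of radius `t (‖e‖ + 1)` to the inner ball of the kernel, of radius `δ
  -- t / 2`. It is independent of `t`, so the average of the oscillation still tends to zero after
  -- multiplication by it.
  set κ := ((‖e‖ + 1) / (δ / 2)) ^ n with hκ
  have hlim : Tendsto (fun t : ℝ => t * (‖e‖ + 1)) (𝓝[>] 0) (𝓝[>] 0) := by
    refine tendsto_nhdsWithin_iff.2 ⟨?_, ?_⟩
    · have : Tendsto (fun t : ℝ => t * (‖e‖ + 1)) (𝓝 0) (𝓝 (0 * (‖e‖ + 1))) :=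
        (continuous_id.mul continuous_const).tendsto 0
      rw [zero_mul] at this
      exact this.mono_left nhdsWithin_le_nhds
    · filter_upwards [self_mem_nhdsWithin] with t ht
      have : 0 < t := ht
      exact mem_Ioi.2 (by positivity)
  have hsmall : ∀ᶠ t in 𝓝[>] (0 : ℝ),
      C * κ * (⨍ y in Metric.closedBall x (t * (‖e‖ + 1)), oscEntries A x y) < ε / 2 := by
    have h1 := (hleb.comp hlim).const_mul (C * κ)
    rw [mul_zero] at h1
    exact h1.eventually_lt_const (half_pos hε)
  filter_upwards [hsmall, hlim (Ioo_mem_nhdsGT (lt_min hR₀ hr₀)), self_mem_nhdsWithin]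
    with t hts htR ht
  have ht0 : 0 < t := ht
  set R := t * (‖e‖ + 1) with hR
  have hRR₀ : R < R₀ := htR.2.trans_le (min_le_left _ _)
  have hRr₀ : R < r₀ := htR.2.trans_le (min_le_right _ _)
  have hRsub : Metric.closedBall x R ⊆ Metric.closedBall x R₀ :=
    Metric.closedBall_subset_closedBall hRR₀.le
  simp only [intrinsicDist, iSup_le_iff]
  -- All smallness conditions on `t` are fixed before `v` appears, so the estimate passes to the
  -- supremum.
  intro v g hvc hvg hH
  refine ENNReal.ofReal_le_ofReal ?_
  have hgood : ∀ᵐ w ∂(volume.restrict (Metric.closedBall x R₀)),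
      (∀ ξ, 0 ≤ hamiltonian A w ξ) ∧ hamiltonian A w (g w) ≤ 1 ∧ ‖g w‖ ≤ L := by
    filter_upwards [hell, ae_restrict_of_ae_restrict_of_subset hR₀Ω hH] with w hw hw1
    refine ⟨fun ξ => le_trans (by positivity) (hw ξ).1, hw1, ?_⟩
    refine Real.le_sqrt_of_sq_le ?_
    have h1 := (hw (g w)).1.trans hw1
    rwa [inv_mul_le_iff₀ (by linarith), mul_one] at h1
  have hlip := fun {y z : Eucl n} => hvg.abs_sub_le (y := y) (z := z) hΩ.measurableSet hvc hR₀Ω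
    (hgood.mono fun w hw => hw.2.2)
  let η : ContDiffBump (0 : Eucl n) :=
    ⟨δ * t / 2, δ * t, half_pos (mul_pos hδ0 ht0), half_lt_self (mul_pos hδ0 ht0)⟩
  have hout : η.rOut = δ * t := rfl
  have hin : η.rIn = δ * t / 2 := rfl
  have hδt : δ * t ≤ t := mul_le_of_le_one_left ht0.le (min_le_left _ _)
  have hxR : dist x x + η.rOut ≤ R := by
    rw [dist_self, hout, hR]
    nlinarith [norm_nonneg e]
  have hxtR : dist (x + t • e) x + η.rOut ≤ R := by
    rw [dist_eq_norm, add_sub_cancel_left, norm_smul, Real.norm_of_nonneg ht0.le, hout, hR]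
    linarith
  have hball : ∀ z, dist z x + η.rOut ≤ R → |mollify η x R v z - v z| ≤ L * (δ * t) := by
    intro z hz
    refine abs_mollify_sub_self_le (hvc.mono (hRsub.trans hR₀Ω)) η hz fun w hw => ?_
    have h1 : dist w z < δ * t := hw
    have h2 := η.rOut_pos
    refine (hlip (y := z) (z := w) ?_ ?_).trans ?_
    · rw [Metric.mem_ball]; linarith
    · rw [Metric.mem_ball]; linarith [dist_triangle w z x]
    · rw [← dist_eq_norm]; gcongr
  have hmain := abs_mollify_sub_le hΩ.measurableSet hvc hvg (hRsub.trans hR₀Ω) η ht0.le hxR hxtR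
    (a := c) (Δ := fun w => C * oscEntries A x w)
    (fun w => mul_nonneg hC0 (oscEntries_nonneg A x w))
    ((hr₀i.mono_set (Metric.closedBall_subset_closedBall hRr₀.le)).const_mul C) (by
      filter_upwards [ae_restrict_of_ae_restrict_of_subset hRsub hgood] with w hw
      exact abs_inner_symApply_le_of_hamiltonian_le_one hw.1 hw.2.1 hw.2.2 hc hcp)
  have hb1 : 0 < volume.real (Metric.ball (0 : Eucl n) 1) :=
    ENNReal.toReal_pos (Metric.measure_ball_pos _ _ one_pos).ne' measure_ball_lt_top.ne
  have hR0 : 0 < R := htR.1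
  have hratio : (∫ w in Metric.closedBall x R, C * oscEntries A x w)
      / volume.real (Metric.closedBall (0 : Eucl n) η.rIn)
      = C * κ * ⨍ y in Metric.closedBall x R, oscEntries A x y := by
    rw [setAverage_eq, integral_const_mul, smul_eq_mul, hin,
      Measure.addHaar_real_closedBall _ _ (by positivity), Measure.addHaar_real_closedBall _ _ hR0.le,
      finrank_euclideanSpace_fin, hκ, show (‖e‖ + 1) / (δ / 2) = R / (δ * t / 2) by
        rw [hR]; field_simp, div_pow R]
    have hD : 0 < (δ * t / 2) ^ n := by positivity
    have hQ : 0 < R ^ n := by positivity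
    generalize (δ * t / 2) ^ n = D at hD ⊢
    generalize R ^ n = Q at hQ ⊢
    field_simp
  rw [hratio] at hmain
  have h1 := hball x hxR
  have h2 := hball (x + t • e) hxtR
  rw [abs_le] at h1 h2 hmain
  have h3 : (c + C * κ * ⨍ y in Metric.closedBall x R, oscEntries A x y) * t
      ≤ (c + ε / 2) * t := by gcongr
  have h4 : 2 * (L * (δ * t)) ≤ ε / 2 * t := by
    calc 2 * (L * (δ * t)) = 2 * (L * δ) * t := by ring
      _ ≤ _ := by gcongr
  linarith [h1.1, h1.2, h2.1, h2.2, hmain.1, hmain.2]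

/-- Along `x + t S(x) p` the increment of `u` is `c² t + o(t)` while the distance is at most `(c +
ε) t`; let `t → 0`, then `ε → 0`. -/
lemma IsDiffusionMatrix.le_pointwiseLip (hΩ : IsOpen Ω)
    (hA : IsDiffusionMatrix Ω A) {x : Eucl n} (hx : x ∈ Ω)
    (hint : ∃ r > 0, IntegrableOn (oscEntries A x) (Metric.closedBall x r))
    (hleb : Tendsto (fun r => ⨍ y in Metric.closedBall x r, oscEntries A x y) (𝓝[>] 0) (𝓝 0))
    {u : Eucl n → ℝ} {p : Eucl n} (hu : HasGradientAt u p x)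
    {c : ℝ} (hc : 0 < c) (hcp : hamiltonian A x p = c ^ 2) :
    ENNReal.ofReal c ≤ pointwiseLip Ω A u x := by
  set e := symApply A x p with he
  have hpe : inner ℝ p e = c ^ 2 := by rw [he, inner_symApply_self, hcp]
  have he0 : e ≠ 0 := by
    rintro h0
    rw [h0, inner_zero_right] at hpe
    exact (pow_pos hc 2).ne hpe
  have hline : HasDerivAt (fun t : ℝ => x + t • e) e 0 := by
    simpa using ((hasDerivAt_id (0 : ℝ)).smul_const e).const_add x
  have htend : Tendsto (fun t : ℝ => x + t • e) (𝓝[>] 0) (𝓝[Ω \ {x}] x) := by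
    have h0 : Tendsto (fun t : ℝ => x + t • e) (𝓝[>] 0) (𝓝 x) := by
      have := hline.continuousAt.tendsto
      simp only [zero_smul, add_zero] at this
      exact this.mono_left nhdsWithin_le_nhds
    refine tendsto_nhdsWithin_iff.2 ⟨h0, ?_⟩
    filter_upwards [h0 (hΩ.mem_nhds hx), self_mem_nhdsWithin] with t ht ht0
    refine ⟨ht, fun h => ?_⟩
    have h1 : t • e = 0 := by simpa using h
    exact (smul_ne_zero (ne_of_gt ht0) he0) h1
  have hder : HasDerivAt (fun t : ℝ => u (x + t • e)) (c ^ 2) 0 := by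
    have h1 : HasFDerivAt u (InnerProductSpace.toDual ℝ (Eucl n) p) (x + (0 : ℝ) • e) := by
      simpa using hu.hasFDerivAt
    have := h1.comp_hasDerivAt 0 hline
    rwa [InnerProductSpace.toDual_apply_apply, hpe] at this
  have key : ∀ ε > 0, ENNReal.ofReal ((c ^ 2 - ε) / (c + ε)) ≤ pointwiseLip Ω A u x := by
    intro ε hε
    refine le_limsup_of_frequently_le ?_
    refine htend.frequently (Eventually.frequently ?_)
    have hslope : ∀ᶠ t in 𝓝[>] (0 : ℝ), (c ^ 2 - ε) < t⁻¹ • (u (x + t • e) - u x) := by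
      have := hder.tendsto_slope_zero_right
      simp only [zero_add, zero_smul, add_zero] at this
      exact this.eventually_const_lt (by linarith)
    filter_upwards [hA.eventually_intrinsicDist_le hΩ hx hint hleb hc hcp hε, hslope,
      self_mem_nhdsWithin] with t ht hs ht0
    have ht0 : 0 < t := ht0
    rw [smul_eq_mul, lt_inv_mul_iff₀ ht0] at hs
    calc ENNReal.ofReal ((c ^ 2 - ε) / (c + ε))
        = ENNReal.ofReal (t * (c ^ 2 - ε)) / ENNReal.ofReal (t * (c + ε)) := by
          rw [← ENNReal.ofReal_div_of_pos (by positivity), mul_div_mul_left _ _ ht0.ne']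
      _ ≤ _ := by
          refine ENNReal.div_le_div (ENNReal.ofReal_le_ofReal ?_) ht
          exact hs.le.trans (le_abs_self _)
  have hlim : Tendsto (fun ε : ℝ => ENNReal.ofReal ((c ^ 2 - ε) / (c + ε))) (𝓝[>] 0)
      (𝓝 (ENNReal.ofReal c)) := by
    have h1 : ContinuousAt (fun ε : ℝ => (c ^ 2 - ε) / (c + ε)) 0 :=
      (continuousAt_const.sub continuousAt_id).div (continuousAt_const.add continuousAt_id)
        (by simpa using hc.ne')
    have h2 := ENNReal.tendsto_ofReal
      (h1.tendsto.mono_left (nhdsWithin_le_nhds (s := Ioi 0)))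
    have h3 : (c ^ 2 - 0) / (c + 0) = c := by field_simp; ring
    rwa [h3] at h2
  refine le_of_tendsto hlim ?_
  filter_upwards [self_mem_nhdsWithin] with ε hε
  exact key ε hε

end UpperBoundOfDistance

/-! ### Test functions and the lower bound for the distance -/

section LowerBoundOfDistance

variable {n : ℕ} {Ω : Set (Eucl n)} {A : Eucl n → Matrix (Fin n) (Fin n) ℝ}

lemma inner_gradient_eq_fderiv (v : Eucl n → ℝ) (x e : Eucl n) :
    inner ℝ (gradient v x) e = fderiv ℝ v x e := by
  simp [gradient]

lemma hasSobolevGradient_gradient {v : Eucl n → ℝ} (hv : ContDiff ℝ ∞ v)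
    (hc : HasCompactSupport v) : HasSobolevGradient Ω v (gradient v) := by
  have hdc : Continuous (fderiv ℝ v) := hv.continuous_fderiv (by simp)
  have hg : Continuous (gradient v) :=
    (InnerProductSpace.toDual ℝ (Eucl n)).symm.continuous.comp hdc
  have hgc : HasCompactSupport (gradient v) :=
    (hc.fderiv ℝ).comp_left (g := (InnerProductSpace.toDual ℝ (Eucl n)).symm) (map_zero _)
  refine ⟨fun K _ _ => (hv.continuous.memLp_of_hasCompactSupport hc).restrict K,
    fun K _ _ => (hg.memLp_of_hasCompactSupport hgc).restrict K, fun φ hφ hφc hφs i => ?_⟩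
  set e : Eucl n := EuclideanSpace.single i 1 with he
  have hφd : Continuous fun x => fderiv ℝ φ x e :=
    (hφ.continuous_fderiv (by simp)).clm_apply continuous_const
  have hvd : Continuous fun x => fderiv ℝ v x e := hdc.clm_apply continuous_const
  have hgi : ∀ x, gradient v x i = fderiv ℝ v x e := fun x => by
    rw [← inner_gradient_eq_fderiv, he, EuclideanSpace.inner_single_right, one_mul, conj_trivial]
  simp only [hgi]
  rw [setIntegral_eq_integral_of_forall_compl_eq_zero (s := Ω),
    setIntegral_eq_integral_of_forall_compl_eq_zero (s := Ω)]
  · refine integral_mul_fderiv_eq_neg_fderiv_mul_of_integrable ?_ ?_ ?_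
      (fun x _ => hv.differentiable (by simp) x) (fun x _ => hφ.differentiable (by simp) x)
    · exact (hvd.mul hφ.continuous).integrable_of_hasCompactSupport hφc.mul_left
    · exact (hv.continuous.mul hφd).integrable_of_hasCompactSupport hc.mul_right
    · exact (hv.continuous.mul hφ.continuous).integrable_of_hasCompactSupport hc.mul_right
  · intro x hx
    rw [image_eq_zero_of_notMem_tsupport fun h => hx (hφs h), mul_zero]
  · intro x hx
    have : fderiv ℝ φ x = 0 := by
      by_contra h0
      exact hx (hφs (support_fderiv_subset ℝ (f := φ) h0))
    simp [this]

/-- If `H(·, q) ≤ κ < 1` near `x`, then a truncation of the linear function `⟨q, ·⟩` is admissible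
for the intrinsic distance. -/
lemma IsDiffusionMatrix.eventually_le_intrinsicDist (hΩ : IsOpen Ω)
    (hA : IsDiffusionMatrix Ω A) {x : Eucl n} (hx : x ∈ Ω) {q : Eucl n} {r κ : ℝ} (hr : 0 < r)
    (hκ0 : 0 ≤ κ) (hκ : κ < 1)
    (hq : ∀ᵐ y ∂(volume.restrict (Metric.closedBall x r)), hamiltonian A y q ≤ κ)
    {ε : ℝ} (hε : 0 < ε) :
    ∀ᶠ y in 𝓝 x, ENNReal.ofReal (inner ℝ q (x - y) - ε * ‖y - x‖) ≤ intrinsicDist Ω A x y := by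
  obtain ⟨R₀, hR₀, Λ, hΛ, hR₀Ω, hell⟩ := hA.exists_closedBall_bound hΩ hx
  set R := min R₀ r with hR
  have hR0 : 0 < R := lt_min hR₀ hr
  have hRR₀ : Metric.closedBall x R ⊆ Metric.closedBall x R₀ :=
    Metric.closedBall_subset_closedBall (min_le_left _ _)
  have hRr : Metric.closedBall x R ⊆ Metric.closedBall x r :=
    Metric.closedBall_subset_closedBall (min_le_right _ _)
  let χ : ContDiffBump x := ⟨R / 2, R, half_pos hR0, half_lt_self hR0⟩
  have hχ : ContDiff ℝ ∞ χ := χ.contDiff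
  have hχc : HasCompactSupport χ := χ.hasCompactSupport
  have hχt : tsupport χ = Metric.closedBall x R := χ.tsupport_eq
  obtain ⟨M, hM⟩ := (hχ.continuous_fderiv (by simp)).bounded_above_of_compact_support (hχc.fderiv ℝ)
  have hM0 : 0 ≤ M := (norm_nonneg _).trans (hM x)
  -- Half of the slack `1 - κ`: the final estimate is `(1 + θ) κ + K s² ≤ κ + 2 θ = 1`.
  set θ := (1 - κ) / 2 with hθ
  have hθ0 : 0 < θ := by rw [hθ]; linarith
  set K := (1 + θ⁻¹) * (Λ * M ^ 2) with hK
  have hK0 : 0 ≤ K := by positivity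
  set s := Real.sqrt (θ / (K + 1)) with hs
  have hs0 : 0 < s := Real.sqrt_pos.2 (by positivity)
  have hs2 : K * s ^ 2 ≤ θ := by
    rw [hs, Real.sq_sqrt (by positivity), mul_div_assoc', div_le_iff₀ (by positivity)]
    nlinarith
  -- The sine has gradient `q` at `x` and a gradient `cos(·) q` elsewhere, so it never costs more
  -- than `H(·, q)`. Its amplitude `s` is small however steep the cutoff is, which controls the term
  -- `a ∇χ`; a linear function lacks this bound.
  set a : Eucl n → ℝ := fun z => s * Real.sin (inner ℝ q (z - x) * s⁻¹) with ha
  have hac : ContDiff ℝ ∞ a := by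
    refine contDiff_const.mul (Real.contDiff_sin.comp ?_)
    exact (contDiff_const.inner ℝ (contDiff_id.sub contDiff_const)).mul contDiff_const
  have had : ∀ z, HasFDerivAt a
      (Real.cos (inner ℝ q (z - x) * s⁻¹) • InnerProductSpace.toDual ℝ (Eucl n) q) z := by
    intro z
    have h1 : HasFDerivAt (fun z => inner ℝ q (z - x)) (InnerProductSpace.toDual ℝ (Eucl n) q) z :=
      (InnerProductSpace.toDual ℝ (Eucl n) q).hasFDerivAt.comp z ((hasFDerivAt_id z).sub_const x)
    refine (((h1.mul_const s⁻¹).sin).const_mul s).congr_fderiv ?_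
    rw [smul_smul, smul_smul]
    congr 1
    field_simp
  set v : Eucl n → ℝ := fun z => a z * χ z with hv
  have hvs : ContDiff ℝ ∞ v := hac.mul hχ
  have hvc : HasCompactSupport v := hχc.mul_left
  have hgrad : ∀ z, gradient v z = (χ z * Real.cos (inner ℝ q (z - x) * s⁻¹)) • q
      + a z • gradient χ z := by
    intro z
    have h1 := (had z).mul (hχ.differentiable (by simp) z).hasFDerivAt
    refine HasGradientAt.gradient (hasGradientAt_iff_hasFDerivAt.2 (h1.congr_fderiv ?_))
    rw [map_add, map_smul, map_smul, gradient, LinearIsometryEquiv.apply_symm_apply, smul_smul,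
      add_comm]
  have hadm : ∀ᵐ z ∂(volume.restrict Ω), hamiltonian A z (gradient v z) ≤ 1 := by
    have h1 := (ae_restrict_iff' Metric.isClosed_closedBall.measurableSet).1
      (ae_restrict_of_ae_restrict_of_subset hRR₀ hell)
    have h2 := (ae_restrict_iff' Metric.isClosed_closedBall.measurableSet).1
      (ae_restrict_of_ae_restrict_of_subset hRr hq)
    filter_upwards [ae_restrict_of_ae h1, ae_restrict_of_ae h2] with z hz1 hz2
    by_cases hz : z ∈ Metric.closedBall x R
    · have hz1 := hz1 hz
      have hz2 := hz2 hz
      have hnn : ∀ ξ, 0 ≤ hamiltonian A z ξ := fun ξ => le_trans (by positivity) (hz1 ξ).1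
      rw [hgrad]
      refine (hamiltonian_add_le hnn _ _ hθ0).trans ?_
      have e1 : hamiltonian A z ((χ z * Real.cos (inner ℝ q (z - x) * s⁻¹)) • q) ≤ κ := by
        rw [hamiltonian_smul]
        have b1 : (χ z * Real.cos (inner ℝ q (z - x) * s⁻¹)) ^ 2 ≤ 1 := by
          rw [mul_pow]
          exact mul_le_one₀ (pow_le_one₀ χ.nonneg χ.le_one) (sq_nonneg _)
            (Real.cos_sq_le_one _)
        exact (mul_le_of_le_one_left (hnn q) b1).trans hz2
      have e2 : hamiltonian A z (a z • gradient χ z) ≤ s ^ 2 * (Λ * M ^ 2) := by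
        rw [hamiltonian_smul]
        have b1 : a z ^ 2 ≤ s ^ 2 := by
          rw [ha, mul_pow]
          exact mul_le_of_le_one_right (sq_nonneg s) (Real.sin_sq_le_one _)
        have b2 : ‖gradient χ z‖ ≤ M := by
          simpa [gradient] using hM z
        have b3 : hamiltonian A z (gradient χ z) ≤ Λ * M ^ 2 := (hz1 _).2.trans (by gcongr)
        exact mul_le_mul b1 b3 (hnn _) (sq_nonneg s)
      calc (1 + θ) * hamiltonian A z ((χ z * Real.cos (inner ℝ q (z - x) * s⁻¹)) • q)
            + (1 + θ⁻¹) * hamiltonian A z (a z • gradient χ z)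
          ≤ (1 + θ) * κ + (1 + θ⁻¹) * (s ^ 2 * (Λ * M ^ 2)) := by gcongr
        _ = κ + θ * κ + K * s ^ 2 := by rw [hK]; ring
        _ ≤ 1 := by nlinarith
    · have h0 : χ z = 0 := image_eq_zero_of_notMem_tsupport (by rwa [hχt])
      have h1 : fderiv ℝ χ z = 0 := by
        by_contra h
        exact hz (hχt ▸ support_fderiv_subset ℝ (f := χ) h)
      have h2 : gradient χ z = 0 := by simp [gradient, h1]
      rw [hgrad, h0, h2]
      simp [hamiltonian_zero]
  have hvx : v x = 0 := by simp [hv, ha]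
  have hvd : HasFDerivAt v (InnerProductSpace.toDual ℝ (Eucl n) q) x := by
    have h1 := (had x).mul (hχ.differentiable (by simp) x).hasFDerivAt
    have h2 : χ x = 1 := χ.one_of_mem_closedBall (Metric.mem_closedBall_self (half_pos hR0).le)
    have h3 : a x = 0 := by simp [ha]
    refine h1.congr_fderiv ?_
    rw [h2, h3]
    simp
  filter_upwards [hvd.isLittleO.def hε] with y hy
  have hle : ENNReal.ofReal (v x - v y) ≤ intrinsicDist Ω A x y :=
    le_iSup_of_le v <| le_iSup_of_le (gradient v) <| le_iSup_of_le hvs.continuous.continuousOn <|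
      le_iSup_of_le (hasSobolevGradient_gradient hvs hvc) <| le_iSup_of_le hadm le_rfl
  refine le_trans (ENNReal.ofReal_le_ofReal ?_) hle
  rw [InnerProductSpace.toDual_apply_apply, Real.norm_eq_abs] at hy
  have h1 : inner ℝ q (x - y) = - inner ℝ q (y - x) := by rw [← inner_neg_right, neg_sub]
  linarith [(abs_le.1 hy).2]

/-- `H` is even, so the one-sided bound applies to both `q` and `-q`. -/
lemma IsDiffusionMatrix.eventually_abs_le_intrinsicDist (hΩ : IsOpen Ω)
    (hA : IsDiffusionMatrix Ω A) {x : Eucl n} (hx : x ∈ Ω) {q : Eucl n} {r κ : ℝ} (hr : 0 < r)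
    (hκ0 : 0 ≤ κ) (hκ : κ < 1)
    (hq : ∀ᵐ y ∂(volume.restrict (Metric.closedBall x r)), hamiltonian A y q ≤ κ)
    {ε : ℝ} (hε : 0 < ε) :
    ∀ᶠ y in 𝓝 x, ENNReal.ofReal (|inner ℝ q (y - x)| - ε * ‖y - x‖) ≤ intrinsicDist Ω A x y := by
  have hq' : ∀ᵐ y ∂(volume.restrict (Metric.closedBall x r)), hamiltonian A y (-q) ≤ κ := by
    filter_upwards [hq] with y hy
    rw [← neg_one_smul ℝ q, hamiltonian_smul]
    simpa using hy
  filter_upwards [hA.eventually_le_intrinsicDist hΩ hx hr hκ0 hκ hq hε,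
    hA.eventually_le_intrinsicDist hΩ hx hr hκ0 hκ hq' hε] with y h1 h2
  have h3 : inner ℝ q (x - y) = - inner ℝ q (y - x) := by rw [← inner_neg_right, neg_sub]
  rw [h3] at h1
  rw [inner_neg_left, h3, neg_neg] at h2
  rcases abs_choice (inner ℝ q (y - x)) with h | h <;> rwa [h]

lemma exists_norm_le_card_mul_abs (hn : 0 < n) (w : Eucl n) : ∃ i, ‖w‖ ≤ n * |w i| := by
  by_contra! h
  have h1 : ‖w‖ ≤ ∑ i, |w i| := by
    rw [EuclideanSpace.norm_eq]
    refine Real.sqrt_le_iff.2 ⟨Finset.sum_nonneg fun _ _ => abs_nonneg _, ?_⟩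
    exact Finset.sum_sq_le_sq_sum_of_nonneg fun _ _ => abs_nonneg _
  have : Nonempty (Fin n) := ⟨⟨0, hn⟩⟩
  have h2 : ∑ i : Fin n, (n : ℝ) * |w i| < ∑ _i : Fin n, ‖w‖ :=
    Finset.sum_lt_sum_of_nonempty Finset.univ_nonempty fun i _ => h i
  rw [← Finset.mul_sum, Finset.sum_const, Finset.card_univ, Fintype.card_fin, nsmul_eq_mul] at h2
  have h3 : (0 : ℝ) < n := by exact_mod_cast hn
  nlinarith

/-- The intrinsic distance dominates the Euclidean one locally. -/
lemma IsDiffusionMatrix.exists_mul_norm_le_intrinsicDist (hn : 0 < n) (hΩ : IsOpen Ω)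
    (hA : IsDiffusionMatrix Ω A) {x : Eucl n} (hx : x ∈ Ω) :
    ∃ c > 0, ∀ᶠ y in 𝓝 x, ENNReal.ofReal (c * ‖y - x‖) ≤ intrinsicDist Ω A x y := by
  obtain ⟨R₀, hR₀, Λ, hΛ, hR₀Ω, hell⟩ := hA.exists_closedBall_bound hΩ hx
  have hn' : (0 : ℝ) < n := by exact_mod_cast hn
  -- Small enough that each `b eᵢ` satisfies `H ≤ b² Λ ≤ 1 / 2`, hence can serve as `q`.
  set b := (2 * Λ)⁻¹ with hb
  have hb0 : 0 < b := by positivity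
  have hb2 : b ^ 2 * Λ ≤ 1 / 2 := by
    have : b * Λ = 1 / 2 := by rw [hb]; field_simp
    have h2 : b ≤ 1 := inv_le_one_of_one_le₀ (by linarith)
    nlinarith
  -- Some coordinate gives `b |wᵢ| ≥ b ‖w‖ / n`. Half of this is spent on the error term of the test
  -- function and the other half is the claimed bound.
  refine ⟨b / (2 * n), by positivity, ?_⟩
  have hall : ∀ i : Fin n, ∀ᶠ y in 𝓝 x, ENNReal.ofReal
      (|inner ℝ (b • EuclideanSpace.single i (1 : ℝ)) (y - x)| - b / (2 * n) * ‖y - x‖)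
        ≤ intrinsicDist Ω A x y := by
    intro i
    refine hA.eventually_abs_le_intrinsicDist hΩ hx hR₀ (κ := 1 / 2) (by norm_num) (by norm_num) ?_
      (by positivity)
    filter_upwards [hell] with w hw
    rw [hamiltonian_smul]
    have := (hw (EuclideanSpace.single i 1)).2
    simp only [PiLp.norm_single, norm_one, one_pow, mul_one] at this
    exact (mul_le_mul_of_nonneg_left this (sq_nonneg b)).trans hb2
  filter_upwards [eventually_all.2 hall] with y hy
  obtain ⟨i, hi⟩ := exists_norm_le_card_mul_abs hn (y - x)
  refine le_trans (ENNReal.ofReal_le_ofReal ?_) (hy i)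
  rw [inner_smul_left, EuclideanSpace.inner_single_left, conj_trivial, map_one, one_mul, abs_mul,
    abs_of_pos hb0]
  have : b / (2 * n) * ‖y - x‖ ≤ b * |(y - x) i| / 2 := by
    calc b / (2 * n) * ‖y - x‖ ≤ b / (2 * n) * (n * |(y - x) i|) := by gcongr
      _ = _ := by field_simp
  linarith

/-- Homogeneity passes from unit vectors to all `d`, and the exceptional set `E` disappears into
"almost every `y`". The null set of bad `x` depends on `d`, so only countably many `d` can be
treated at once. -/
lemma WeakUSCOn.ae_eventually_le (hΩ : IsOpen Ω) (h : WeakUSCOn Ω A) (d : Eucl n) :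
    ∀ᵐ x ∂(volume.restrict Ω), ∀ ε > 0, ∃ r > 0,
      ∀ᵐ y ∂(volume.restrict (Metric.closedBall x r)),
        hamiltonian A y d ≤ hamiltonian A x d + ε := by
  by_cases hd : d = 0
  · refine Eventually.of_forall fun x ε hε => ⟨1, one_pos, Eventually.of_forall fun y => ?_⟩
    simp only [hd, hamiltonian_zero]
    linarith
  have hd0 : 0 < ‖d‖ := norm_pos_iff.2 hd
  set ξ := ‖d‖⁻¹ • d with hξ
  have hξ1 : ‖ξ‖ = 1 := by
    rw [hξ, norm_smul, norm_inv, norm_norm, inv_mul_cancel₀ hd0.ne']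
  have hdξ : d = ‖d‖ • ξ := by rw [hξ, smul_inv_smul₀ hd0.ne']
  filter_upwards [h ξ hξ1, ae_restrict_mem hΩ.measurableSet] with x hx hxΩ ε hε
  obtain ⟨E, hE, hlim⟩ := hx
  have h1 : ((hamiltonian A x ξ : ℝ) : EReal) < ((hamiltonian A x ξ + ε / ‖d‖ ^ 2 : ℝ) : EReal) :=
    EReal.coe_lt_coe_iff.2 (by linarith [div_pos hε (pow_pos hd0 2)])
  have h2 := eventually_lt_of_limsup_lt (hlim.trans_lt h1)
  rw [eventually_nhdsWithin_iff] at h2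
  obtain ⟨r, hr, hr'⟩ := Metric.nhds_basis_closedBall.eventually_iff.1
    (h2.and (hΩ.eventually_mem hxΩ))
  refine ⟨r, hr, ?_⟩
  filter_upwards [ae_restrict_of_ae (compl_mem_ae_iff.2 hE),
    ae_restrict_mem Metric.isClosed_closedBall.measurableSet] with y hyE hyr
  have h3 := EReal.coe_lt_coe_iff.1 ((hr' hyr).1 ⟨(hr' hyr).2, hyE⟩)
  have h3 : hamiltonian A y ξ ≤ hamiltonian A x ξ + ε / ‖d‖ ^ 2 := h3.le
  have h6 : ∀ z, hamiltonian A z d = ‖d‖ ^ 2 * hamiltonian A z ξ := fun z => by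
    rw [← hamiltonian_smul, ← hdξ]
  rw [h6, h6]
  have h4 : ‖d‖ ^ 2 * hamiltonian A y ξ ≤ ‖d‖ ^ 2 * (hamiltonian A x ξ + ε / ‖d‖ ^ 2) := by gcongr
  have h5 : ‖d‖ ^ 2 * (hamiltonian A x ξ + ε / ‖d‖ ^ 2) = ‖d‖ ^ 2 * hamiltonian A x ξ + ε := by
    field_simp
  linarith

/-- Approximate `p` by some `d k` and use `q = d k / (c + 2η)`, for which `H(·, q)` stays below one
near `x`. The distance then dominates `|⟨p, y - x⟩| / (c + 2η)` up to errors of order `η ‖y - x‖`.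
The shift by `2η` also covers `c = 0`. -/
lemma IsDiffusionMatrix.pointwiseLip_le (hn : 0 < n) (hΩ : IsOpen Ω)
    (hA : IsDiffusionMatrix Ω A) {x : Eucl n} (hx : x ∈ Ω) {ι : Type*} {d : ι → Eucl n}
    (hd : DenseRange d)
    (husc : ∀ k, ∀ ε > 0, ∃ r > 0, ∀ᵐ y ∂(volume.restrict (Metric.closedBall x r)),
      hamiltonian A y (d k) ≤ hamiltonian A x (d k) + ε)
    {u : Eucl n → ℝ} {p : Eucl n} (hu : HasGradientAt u p x)
    {c : ℝ} (hc : 0 ≤ c) (hcp : hamiltonian A x p = c ^ 2) :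
    pointwiseLip Ω A u x ≤ ENNReal.ofReal c := by
  obtain ⟨b, hb, hdist⟩ := hA.exists_mul_norm_le_intrinsicDist hn hΩ hx
  have key : ∀ η > 0, pointwiseLip Ω A u x
      ≤ ENNReal.ofReal (c + 2 * η + (c + 2 * η + 2) * η / b) := by
    intro η hη
    obtain ⟨k, hk1, hk2⟩ : ∃ k, ‖p - d k‖ < η ∧ hamiltonian A x (d k) < (c + η) ^ 2 := by
      have hopen : IsOpen {z : Eucl n | ‖p - z‖ < η ∧ hamiltonian A x z < (c + η) ^ 2} :=
        (isOpen_lt (continuous_const.sub continuous_id).norm continuous_const).inter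
          (isOpen_lt (continuous_hamiltonian A x) continuous_const)
      refine hd.exists_mem_open hopen ⟨p, by simpa using hη, ?_⟩
      rw [hcp]
      nlinarith
    -- The gap is used up completely: `H(y, d k) ≤ (c + η)²` near `x`, and division by `τ = c + 2η`
    -- leaves a constant strictly below one.
    obtain ⟨r, hr, hr'⟩ := husc k ((c + η) ^ 2 - hamiltonian A x (d k)) (by linarith)
    set τ := c + 2 * η with hτ
    have hτ0 : 0 < τ := by positivity
    have hκ : ((c + η) / τ) ^ 2 < 1 := by
      refine pow_lt_one₀ (by positivity) ?_ two_ne_zero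
      rw [div_lt_one hτ0]
      linarith
    have hq : ∀ᵐ y ∂(volume.restrict (Metric.closedBall x r)),
        hamiltonian A y (τ⁻¹ • d k) ≤ ((c + η) / τ) ^ 2 := by
      filter_upwards [hr'] with y hy
      rw [hamiltonian_smul, div_eq_inv_mul, mul_pow]
      gcongr
      linarith
    refine limsup_le_of_le (by isBoundedDefault) ?_
    refine Filter.Eventually.filter_mono nhdsWithin_le_nhds ?_
    filter_upwards [hdist,
      hA.eventually_abs_le_intrinsicDist hΩ hx hr (sq_nonneg _) hκ hq hη,
      hu.hasFDerivAt.isLittleO.def hη] with y h1 h2 h3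
    rw [InnerProductSpace.toDual_apply_apply, Real.norm_eq_abs] at h3
    refine ENNReal.div_le_of_le_mul ?_
    set w := y - x with hw
    have h4 : |inner ℝ p w| ≤ |inner ℝ (d k) w| + η * ‖w‖ := by
      have e1 : inner ℝ p w = inner ℝ (d k) w + inner ℝ (p - d k) w := by
        rw [← inner_add_left, add_sub_cancel]
      rw [e1]
      refine (abs_add_le _ _).trans ?_
      gcongr
      exact (abs_real_inner_le_norm _ _).trans (by gcongr)
    have h5 : |inner ℝ (d k) w| = τ * |inner ℝ (τ⁻¹ • d k) w| := by
      rw [inner_smul_left, conj_trivial, abs_mul, abs_of_pos (inv_pos.2 hτ0),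
        mul_inv_cancel_left₀ hτ0.ne']
    -- The error `(τ + 2) η ‖w‖` collects `η ‖w‖` from differentiability, `η ‖w‖` from replacing `p`
    -- by `d k`, and `τ η ‖w‖` from the test function. It is written with `b * ‖w‖`, which the
    -- distance dominates.
    have h6 : |u y - u x| ≤ τ * (|inner ℝ (τ⁻¹ • d k) w| - η * ‖w‖)
        + (τ + 2) * η / b * (b * ‖w‖) := by
      have e1 : (τ + 2) * η / b * (b * ‖w‖) = (τ + 2) * η * ‖w‖ := by field_simp
      have e2 : |u y - u x| ≤ |u y - u x - inner ℝ p w| + |inner ℝ p w| := by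
        simpa using abs_add_le (u y - u x - inner ℝ p w) (inner ℝ p w)
      rw [e1]
      rw [h5] at h4
      linarith
    calc ENNReal.ofReal |u y - u x|
        ≤ ENNReal.ofReal (τ * (|inner ℝ (τ⁻¹ • d k) w| - η * ‖w‖)
          + (τ + 2) * η / b * (b * ‖w‖)) := ENNReal.ofReal_le_ofReal h6
      _ ≤ ENNReal.ofReal (τ * (|inner ℝ (τ⁻¹ • d k) w| - η * ‖w‖))
          + ENNReal.ofReal ((τ + 2) * η / b * (b * ‖w‖)) := ENNReal.ofReal_add_le
      _ = ENNReal.ofReal τ * ENNReal.ofReal (|inner ℝ (τ⁻¹ • d k) w| - η * ‖w‖)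
          + ENNReal.ofReal ((τ + 2) * η / b) * ENNReal.ofReal (b * ‖w‖) := by
        rw [ENNReal.ofReal_mul hτ0.le, ENNReal.ofReal_mul (by positivity)]
      _ ≤ ENNReal.ofReal τ * intrinsicDist Ω A x y
          + ENNReal.ofReal ((τ + 2) * η / b) * intrinsicDist Ω A x y := by gcongr
      _ = _ := by rw [← add_mul, ← ENNReal.ofReal_add hτ0.le (by positivity)]
  have hlim : Tendsto (fun η : ℝ => ENNReal.ofReal (c + 2 * η + (c + 2 * η + 2) * η / b))
      (𝓝[>] 0) (𝓝 (ENNReal.ofReal c)) := by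
    have h1 : Continuous fun η : ℝ => c + 2 * η + (c + 2 * η + 2) * η / b := by fun_prop
    have h2 := ENNReal.tendsto_ofReal ((h1.tendsto 0).mono_left (nhdsWithin_le_nhds (s := Ioi 0)))
    simpa using h2
  refine ge_of_tendsto hlim ?_
  filter_upwards [self_mem_nhdsWithin] with η hη
  exact key η hη

end LowerBoundOfDistance

end IntrinsicDistance

/-! ### Conclusion at almost every point -/

open IntrinsicDistance in
theorem theorem2p2 (n : ℕ) (hn : 2 ≤ n)
    (Ω : Set (IntrinsicDistance.Eucl n)) (hΩo : IsOpen Ω) (hΩc : IsConnected Ω)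
    (A : IntrinsicDistance.Eucl n → Matrix (Fin n) (Fin n) ℝ)
    (hA : IntrinsicDistance.IsDiffusionMatrix Ω A)
    (hwusc : IntrinsicDistance.WeakUSCOn Ω A)
    (u : IntrinsicDistance.Eucl n → ℝ) (hu : ∃ K : NNReal, LipschitzOnWith K u Ω) :
    ∀ᵐ x ∂(volume.restrict Ω), DifferentiableAt ℝ u x ∧
      IntrinsicDistance.pointwiseLip Ω A u x ^ 2 =
        ENNReal.ofReal (IntrinsicDistance.hamiltonian A x (gradient u x)) := by
  obtain ⟨K, hK⟩ := hu
  obtain ⟨lam, -, hl1, hle⟩ := hA.elliptic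
  have husc : ∀ᵐ x ∂(volume.restrict Ω), ∀ k : ℕ, ∀ ε > 0, ∃ r > 0,
      ∀ᵐ y ∂(volume.restrict (Metric.closedBall x r)),
        hamiltonian A y (TopologicalSpace.denseSeq (Eucl n) k)
          ≤ hamiltonian A x (TopologicalSpace.denseSeq (Eucl n) k) + ε :=
    ae_all_iff.2 fun k => hwusc.ae_eventually_le hΩo _
  filter_upwards [hK.ae_differentiableWithinAt hΩo.measurableSet,
    ae_restrict_mem hΩo.measurableSet, hle, husc, hA.ae_tendsto_average_oscEntries hΩo]
    with x hdiff hx hell husc hleb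
  have hd : DifferentiableAt ℝ u x := hdiff.differentiableAt (hΩo.mem_nhds hx)
  refine ⟨hd, ?_⟩
  have hlam : 0 < lam x := one_pos.trans_le (hl1 x hx)
  set p := gradient u x with hp
  have hH0 : 0 ≤ hamiltonian A x p := le_trans (by positivity) (hell p).1
  set c := Real.sqrt (hamiltonian A x p) with hc
  have hcp : hamiltonian A x p = c ^ 2 := (Real.sq_sqrt hH0).symm
  have hc0 : 0 ≤ c := Real.sqrt_nonneg _
  have hle : pointwiseLip Ω A u x ≤ ENNReal.ofReal c :=
    hA.pointwiseLip_le (by omega) hΩo hx (TopologicalSpace.denseRange_denseSeq (Eucl n)) husc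
      hd.hasGradientAt hc0 hcp
  have hge : ENNReal.ofReal c ≤ pointwiseLip Ω A u x := by
    -- If `c = 0` the bound is trivial; the argument along `S(x) p` divides by `c` and needs a
    -- nonzero direction.
    rcases hc0.eq_or_lt with h0 | h0
    · simp [← h0]
    · exact hA.le_pointwiseLip hΩo hx hleb.1 hleb.2 hd.hasGradientAt h0 hcp
  rw [hcp, le_antisymm hle hge, ENNReal.ofReal_pow hc0]
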